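/- **Conventions.** Let $\mathcal C$ be a triangulated category. A $t$-structure $\mathcal D$ on $\mathcal C$ is given by strictly full subcategories $\mathcal D^{\le m}=\mathcal D^{\le 0}[-m]$, $\mathcal D^{\ge m}=\mathcal D^{\ge 0}[-m]$ ($m\in\mathbb Z$); its heart is $\mathcal H_{\mathcal D}=\mathcal D^{\le 0}\cap\mathcal D^{\ge 0}$, and $\mathcal D^{\ge 0}$ is called its co-aisle. A pair $(\mathcal D,\mathcal T)$ of $t$-structures on $\mathcal C$ is *right filterable* if $\mathcal D^{\ge i}\cap\mathcal T^{\ge 0}$ is the co-aisle of a $t$-structure for every $i\in\mathbb Z$. It is *of type $(n,k)$*, with $n\in\mathbb N$ and $k\in\mathbb Z$, if $k$ is the largest integer with $\mathcal T^{\le k}\subseteq\mathcal D^{\le 0}$ and $n$ is the least natural number with $\mathcal D^{\le -n}\subseteq\mathcal T^{\le k}$. For a right filterable pair let $\mathcal D_i$ be the unique $t$-structure with co-aisle $\mathcal D^{\ge -i}\cap\mathcal T^{\ge 0}$, let $\mathcal H_i$ be its heart, and put $\mathcal X_i=\mathcal D_{i+1}^{\le 0}\cap\mathcal H_i$ and $\mathcal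 Y_i=\mathcal D_{i+1}^{\ge 1}\cap\mathcal H_i$. An object $A$ is *$\mathcal T$-static of degree $d$* if $A\in\mathcal H_{\mathcal T}[-d]$. **Theorem.** Let $(\mathcal D,\mathcal T)$ be a right filterable pair of $t$-structures of type $(n,0)$ on $\mathcal C$. Then $(\mathcal X_\ell,\mathcal Y_\ell)$ is a torsion pair in $\mathcal H_\ell$ for $0\le\ell\le n-1$, and every object $X$ of $\mathcal H_{\mathcal D}$ has a right $t$-tree, functorial in $X$: there are functors $X\mapsto X_{i_1\dots i_\ell}$ from $\mathcal H_{\mathcal D}$ to $\mathcal C$, one for each word $i_1\dots i_\ell$ in $\{0,1\}$ with $0\le\ell\le n$, the functor of the empty word being the inclusion (so the root is $X$ itself), and, for each word of length $\ell\le n-1$, natural transformations $X_{i_1\dots i_\ell 0}\to X_{i_1\dots i_\ell}\to X_{i_1\dots i_\ell 1}$, such that for every $X\in\mathcal H_{\mathcal D}$ and every word $i_1\dots i_\ell$ with $0\le \ell\le n-1$ the sequence $$0\to X_{i_1\dots i_\ell 0}\to X_{i_1\dots i_\ell}\to X_{i_1\dots i_\ell 1}\to 0$$ is a short exact sequence in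 $\mathcal H_\ell[-(i_1+\dots+i_\ell)]$ with $X_{i_1\dots i_\ell 0}\in\mathcal X_\ell[-(i_1+\dots+i_\ell)]$ and $X_{i_1\dots i_\ell 1}\in\mathcal Y_\ell[-(i_1+\dots+i_\ell)]$. Consequently, each of the $2^n$ leaves $X_{i_1\dots i_n}$ is $\mathcal T$-static of degree $i_1+\dots+i_n$. -/

import Mathlib

open CategoryTheory CategoryTheory.Limits CategoryTheory.Triangulated
  CategoryTheory.Pretriangulated

universe v u

namespace TTree

/-- `A ⟶ B ⟶ E` is a short exact sequence in the full subcategory `P`: the three objects lie in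
`P` and `0 → A → B → E → 0` is short exact there (kernels, cokernels, monomorphisms and
epimorphisms are those of the full subcategory, not those of the ambient category). -/
def ShortExactIn {C : Type u} [Category.{v} C] [Preadditive C] (P : ObjectProperty C)
    {A B E : C} (f : A ⟶ B) (g : B ⟶ E) : Prop :=
  ∃ (hA : P A) (hB : P B) (hE : P E) (w : f ≫ g = 0),
    (ShortComplex.mk (C := P.FullSubcategory)
      (X₁ := ⟨A, hA⟩) (X₂ := ⟨B, hB⟩) (X₃ := ⟨E, hE⟩)
      (ObjectProperty.homMk f) (ObjectProperty.homMk g)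
      (ObjectProperty.hom_ext P w)).ShortExact

/-- `(X, Y)` is a torsion pair in the full subcategory `P` (which is abelian in the
applications). -/
structure IsTorsionPairIn {C : Type u} [Category.{v} C] [Preadditive C] (P : ObjectProperty C)
    (X Y : ObjectProperty C) : Prop where
  left_le : X ≤ P
  right_le : Y ≤ P
  hom_eq_zero : ∀ ⦃A B : C⦄ (f : A ⟶ B), X A → Y B → f = 0
  exists_shortExact : ∀ ⦃B : C⦄, P B → ∃ (A E : C) (f : A ⟶ B) (g : B ⟶ E),
    X A ∧ Y E ∧ ShortExactIn P f g

section

variable {C : Type u} [Category.{v} C] [Preadditive C] [HasZeroObject C] [HasShift C ℤ]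
  [∀ k : ℤ, (shiftFunctor C k).Additive] [Pretriangulated C]

/-- An object is `T`-static of degree `d` if it lies in `H_T[-d]`, that is, `A[d]` lies in the
heart of `T`. -/
def IsStatic (T : TStructure C) (d : ℤ) (A : C) : Prop := (T.heart.shift d) A

/-- The pair `(D, T)` has type `(n, k)`: the shift `k` is the largest integer such that
`T^{≤ k} ⊆ D^{≤ 0}`, and the gap `n` is the least natural number such that
`D^{≤ -n} ⊆ T^{≤ k}`. -/
def IsOfType (D T : TStructure C) (n : ℕ) (k : ℤ) : Prop :=
  IsGreatest {j : ℤ | T.le j ≤ D.le 0} k ∧ IsLeast {m : ℕ | D.le (-(m : ℤ)) ≤ T.le k} n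

/-- A full subcategory is a co-aisle if it is the class `T^{≥ 0}` of some t-structure `T`. -/
def IsCoaisle (P : ObjectProperty C) : Prop := ∃ T : TStructure C, T.ge 0 = P

/-- The pair `(D, T)` is right filterable: `D^{≥ i} ∩ T^{≥ 0}` is a co-aisle for all `i`. -/
def RightFilterable (D T : TStructure C) : Prop := ∀ i : ℤ, IsCoaisle (D.ge i ⊓ T.ge 0)

/-- A t-structure is determined by its co-aisle. -/
theorem eq_of_ge_zero_eq {S T : TStructure C} (h : S.ge 0 = T.ge 0) : S = T := by
  have hge : S.ge = T.ge := by
    funext m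
    rw [← S.shift_ge m 0 m (by simp), ← T.shift_ge m 0 m (by simp), h]
  have hle : S.le = T.le := by
    funext m
    ext A
    rw [S.le_iff_isLE, T.le_iff_isLE, S.isLE_iff_orthogonal m (m + 1) rfl,
      T.isLE_iff_orthogonal m (m + 1) rfl]
    have key : ∀ Y : C, S.IsGE Y (m + 1) ↔ T.IsGE Y (m + 1) := fun Y => by
      rw [← S.ge_iff_isGE, ← T.ge_iff_isGE, hge]
    simp only [key]
  cases S
  cases T
  simp only at hge hle
  subst hge hle
  rfl

variable {D T : TStructure C}

/-- The right basic t-structure `D_i` of a right filterable pair `(D, T)`: the t-structure with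
co-aisle `D^{≥ -i} ∩ T^{≥ 0}`. -/
noncomputable def basic (h : RightFilterable D T) (i : ℤ) : TStructure C :=
  (h (-i)).choose

theorem basic_ge_zero (h : RightFilterable D T) (i : ℤ) :
    (basic h i).ge 0 = D.ge (-i) ⊓ T.ge 0 :=
  (h (-i)).choose_spec

/-- The right basic t-structure is the only t-structure with its defining property. -/
theorem eq_basic (h : RightFilterable D T) (i : ℤ) (S : TStructure C)
    (hS : S.ge 0 = D.ge (-i) ⊓ T.ge 0) : S = basic h i :=
  eq_of_ge_zero_eq (hS.trans (basic_ge_zero h i).symm)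

/-- The right basic heart `H_i`. -/
noncomputable def basicHeart (h : RightFilterable D T) (i : ℤ) : ObjectProperty C :=
  (basic h i).heart

/-- The right basic torsion class `X_i = D_{i+1}^{≤ 0} ∩ H_i`. -/
noncomputable def torsionClass (h : RightFilterable D T) (i : ℤ) : ObjectProperty C :=
  (basic h (i + 1)).le 0 ⊓ basicHeart h i

/-- The right basic torsion-free class `Y_i = D_{i+1}^{≥ 1} ∩ H_i`. -/
noncomputable def torsionFreeClass (h : RightFilterable D T) (i : ℤ) : ObjectProperty C :=
  (basic h (i + 1)).ge 1 ⊓ basicHeart h i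

end

/-- A vertex of the infinite binary tree, at the level given by the length of the list: the vertex
`i₁ i₂ … i_ℓ` is the list `[i_ℓ, …, i₂, i₁]`, its last letter first, so that its two children
`i₁ … i_ℓ 0` and `i₁ … i_ℓ 1` are `0 :: w` and `1 :: w`. -/
abbrev Word : Type := List (Fin 2)

/-- The degree `i₁ + ⋯ + i_ℓ` of a vertex. -/
def Word.degree (w : Word) : ℕ := (w.map Fin.val).sum

end TTree

namespace TTree

open scoped ZeroObject

/-! Consecutive basic t-structures satisfy $D_{l+1}^{\ge 1}\subseteq D_l^{\ge 0}\subseteq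
D_{l+1}^{\ge 0}$ (`isTilt_basic`). So the $D_{l+1}$-truncation triangle of an object of $H_l[-d]$,
cut between $d$ and $d+1$, stays in $H_l[-d]$ and is short exact there, with ends in $X_l[-d]$ and
$Y_l[-d]$. Since $X_l\subseteq H_{l+1}$ and $Y_l\subseteq H_{l+1}[-1]$, the letter 0 keeps the
degree, the letter 1 raises it by one, and the construction iterates. Type $(n,0)$ gives $D_0=D$ and
$D_n=T$, which settles root and leaves. Functoriality is that of truncation. -/

/-- A short complex whose first map is a kernel of the second and whose second map is a cokernel
of the first is short exact; no homology is assumed to exist. -/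
theorem shortExact_of_isLimit_of_isColimit {A : Type*} [Category* A] [HasZeroMorphisms A]
    [HasZeroObject A] (S : ShortComplex A)
    (hf : IsLimit (KernelFork.ofι S.f S.zero)) (hg : IsColimit (CokernelCofork.ofπ S.g S.zero)) :
    S.ShortExact := by
  have hf' : hf.lift (KernelFork.ofι S.f S.zero) = 𝟙 S.X₁ :=
    Fork.IsLimit.hom_ext hf (by simp)
  have hg' : hg.desc (CokernelCofork.ofπ S.g S.zero) = 𝟙 S.X₃ :=
    Cofork.IsColimit.hom_ext hg (by simp)
  have : Mono S.f := mono_of_isLimit_fork hf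
  have : Epi S.g := epi_of_isColimit_cofork hg
  -- Cycles `S.X₁`, opcycles `S.X₃`, homology `0`: by `hf'` and `hg'` the induced maps are
  -- identities, with zero cokernel and kernel.
  refine { exact := ⟨⟨⟨⟨S.X₁, 0, S.f, 0, S.zero, hf, comp_zero, ?_⟩,
    ⟨S.X₃, 0, S.g, 0, S.zero, hg, zero_comp, ?_⟩, Iso.refl _, ?_⟩, isZero_zero A⟩⟩ }
  · refine CokernelCofork.IsColimit.ofπ _ _ (fun _ _ => 0) (fun k hk => ?_)
      (fun _ _ _ _ => (isZero_zero A).eq_of_src _ _)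
    rw [hf'] at hk
    simpa using! hk.symm
  · refine KernelFork.IsLimit.ofι _ _ (fun _ _ => 0) (fun k hk => ?_)
      (fun _ _ _ _ => (isZero_zero A).eq_of_tgt _ _)
    rw [hg'] at hk
    simpa using! hk.symm
  · simp

variable {C : Type u} [Category.{v} C] [Preadditive C] [HasZeroObject C] [HasShift C ℤ]
  [∀ k : ℤ, (shiftFunctor C k).Additive] [Pretriangulated C]

theorem heart_shift_iff (t : TStructure C) (d : ℤ) (A : C) :
    t.heart.shift d A ↔ t.IsLE A d ∧ t.IsGE A d := by
  rw [ObjectProperty.prop_shift_iff, t.mem_heart_iff, t.isLE_shift_iff A d d 0,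
    t.isGE_shift_iff A d d 0]

/-- A distinguished triangle with vertices in a shifted heart is short exact there. -/
theorem shortExactIn_heart_shift (t : TStructure C) (d : ℤ) {A B E : C} {f : A ⟶ B} {g : B ⟶ E}
    {h : E ⟶ A⟦(1 : ℤ)⟧} (hT : Triangle.mk f g h ∈ distTriang C)
    (hA : t.heart.shift d A) (hB : t.heart.shift d B) (hE : t.heart.shift d E) :
    ShortExactIn (t.heart.shift d) f g := by
  have w : f ≫ g = 0 := comp_distTriang_mor_zero₁₂ _ hT
  have hA' := (heart_shift_iff t d A).1 hA
  have hE' := (heart_shift_iff t d E).1 hE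
  have := hA'.1
  have := hE'.2
  have : t.IsGE (E⟦(-1 : ℤ)⟧) (d + 1) := t.isGE_shift E d (-1) (d + 1)
  have : t.IsLE (A⟦(1 : ℤ)⟧) (d - 1) := t.isLE_shift A d 1 (d - 1)
  -- The obstructions to cancelling `f` and `g` factor through `E⟦-1⟧` and `A⟦1⟧`, which lie one
  -- degree too far. This gives uniqueness of factorizations; existence comes from exactness of Hom.
  have hf {W : C} (hW : t.heart.shift d W) (k : W ⟶ A) (hk : k ≫ f = 0) : k = 0 := by
    have := ((heart_shift_iff t d W).1 hW).1
    obtain ⟨l, rfl⟩ := Triangle.coyoneda_exact₂ _ (inv_rot_of_distTriang _ hT) k hk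
    rw [show l = 0 from t.zero_of_isLE_of_isGE l d (d + 1) (by lia) ‹_› ‹_›]
    exact zero_comp
  have hg {W : C} (hW : t.heart.shift d W) (k : E ⟶ W) (hk : g ≫ k = 0) : k = 0 := by
    have := ((heart_shift_iff t d W).1 hW).2
    obtain ⟨l, rfl⟩ := Triangle.yoneda_exact₃ _ hT k hk
    rw [show l = 0 from t.zero_of_isLE_of_isGE l (d - 1) d (by lia) ‹_› ‹_›]
    exact comp_zero
  have : (t.heart.shift d).ContainsZero := ⟨0, isZero_zero C, (heart_shift_iff t d 0).2
    ⟨t.isLE_of_isZero (isZero_zero C) d, t.isGE_of_isZero (isZero_zero C) d⟩⟩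
  refine ⟨hA, hB, hE, w, shortExact_of_isLimit_of_isColimit _ ?_ ?_⟩
  · have hlift {W : (t.heart.shift d).FullSubcategory} (k : W ⟶ ⟨B, hB⟩)
        (hk : k ≫ ObjectProperty.homMk g = (0 : W ⟶ ⟨E, hE⟩)) : ∃ l : W.obj ⟶ A, k.hom = l ≫ f :=
      Triangle.coyoneda_exact₂ _ hT k.hom (congrArg (fun m => m.hom) hk)
    refine KernelFork.IsLimit.ofι _ _ (fun k hk => ObjectProperty.homMk (hlift k hk).choose)
      (fun k hk => ObjectProperty.hom_ext _ (hlift k hk).choose_spec.symm) (fun {W} k hk m hm => ?_)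
    refine ObjectProperty.hom_ext _ (sub_eq_zero.1 (hf W.property _ ?_))
    rw [Preadditive.sub_comp, sub_eq_zero]
    exact (congrArg (fun m => m.hom) hm).trans (hlift k hk).choose_spec
  · have hdesc {W : (t.heart.shift d).FullSubcategory} (k : ⟨B, hB⟩ ⟶ W)
        (hk : ObjectProperty.homMk f ≫ k = (0 : ⟨A, hA⟩ ⟶ W)) : ∃ l : E ⟶ W.obj, k.hom = g ≫ l :=
      Triangle.yoneda_exact₂ _ hT k.hom (congrArg (fun m => m.hom) hk)
    refine CokernelCofork.IsColimit.ofπ _ _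
      (fun k hk => ObjectProperty.homMk (hdesc k hk).choose)
      (fun k hk => ObjectProperty.hom_ext _ (hdesc k hk).choose_spec.symm)
      (fun {W} k hk m hm => ?_)
    refine ObjectProperty.hom_ext _ (sub_eq_zero.1 (hg W.property _ ?_))
    rw [Preadditive.comp_sub, sub_eq_zero]
    exact (congrArg (fun m => m.hom) hm).trans (hdesc k hk).choose_spec

/-- `S` is a tilt of `t`: their co-aisles satisfy `S^{≥ 1} ⊆ t^{≥ 0} ⊆ S^{≥ 0}`. -/
structure IsTilt (t S : TStructure C) : Prop where
  ge_zero_le : t.ge 0 ≤ S.ge 0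
  ge_one_le : S.ge 1 ≤ t.ge 0

/-- An inclusion between the classes `≥` of two t-structures may be shifted. -/
theorem ge_le_ge_shift {s t : TStructure C} {a b : ℤ} (h : s.ge a ≤ t.ge b) (d : ℤ) :
    s.ge (a + d) ≤ t.ge (b + d) := by
  rw [← s.shift_ge d a (a + d) (add_comm _ _), ← t.shift_ge d b (b + d) (add_comm _ _)]
  exact fun X hX => h _ hX

/-- Inclusions between aisles are reversed inclusions between co-aisles. -/
theorem le_le_le_iff {s t : TStructure C} {a b : ℤ} :
    s.le a ≤ t.le b ↔ t.ge (b + 1) ≤ s.ge (a + 1) := by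
  constructor
  · intro h X hX
    rw [s.ge_iff_isGE, s.isGE_iff_orthogonal a _ rfl]
    exact fun Y f hY => t.zero_of_isLE_of_isGE f b (b + 1) (by lia)
      ⟨h Y (s.le_of_isLE Y a)⟩ ⟨hX⟩
  · intro h X hX
    rw [t.le_iff_isLE, t.isLE_iff_orthogonal b _ rfl]
    exact fun Y f hY => s.zero_of_isLE_of_isGE f a (a + 1) (by lia) ⟨hX⟩
      ⟨h Y (t.ge_of_isGE Y (b + 1))⟩

namespace IsTilt

variable {t S : TStructure C} (hS : IsTilt t S)
include hS

theorem le_le (d : ℤ) : S.le d ≤ t.le d :=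
  le_le_le_iff.2 (by simpa using ge_le_ge_shift hS.ge_zero_le (d + 1))

theorem le_le_add_one (d : ℤ) : t.le d ≤ S.le (d + 1) :=
  le_le_le_iff.2 (by simpa [add_comm, add_left_comm] using ge_le_ge_shift hS.ge_one_le (d + 1))

theorem ge_add_one_le (d : ℤ) : S.ge (d + 1) ≤ t.ge d := by
  simpa [add_comm] using ge_le_ge_shift hS.ge_one_le d

/-- Truncating for a tilt keeps the left part in the shifted heart. -/
theorem heart_shift_truncLT {d : ℤ} {B : C} (hB : t.heart.shift d B) :
    t.heart.shift d ((S.truncLT (d + 1)).obj B) := by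
  rw [heart_shift_iff] at hB ⊢
  have := hB.2
  have hE : t.IsGE ((S.truncGE (d + 1)).obj B) d := ⟨hS.ge_add_one_le d _ (S.ge_of_isGE _ _)⟩
  have hE' : t.IsGE (((S.truncGE (d + 1)).obj B)⟦(-1 : ℤ)⟧) (d + 1) :=
    t.isGE_shift _ d (-1) (d + 1)
  -- The left part is an extension of `B` by the right part shifted by `-1`, both in `t.ge d`.
  exact ⟨⟨hS.le_le d _ (S.isLE_truncLT_obj B (d + 1) d).le⟩,
    t.isGE₂ _ (inv_rot_of_distTriang _ (S.triangleLTGE_distinguished (d + 1) B)) d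
      (t.isGE_of_ge (((S.truncGE (d + 1)).obj B)⟦(-1 : ℤ)⟧) d (d + 1)) hB.2⟩

/-- Truncating for a tilt keeps the right part in the shifted heart. -/
theorem heart_shift_truncGE {d : ℤ} {B : C} (hB : t.heart.shift d B) :
    t.heart.shift d ((S.truncGE (d + 1)).obj B) := by
  have hA := ((heart_shift_iff _ _ _).1 (hS.heart_shift_truncLT hB)).1
  rw [heart_shift_iff] at hB ⊢
  have hA' : t.IsLE (((S.truncLT (d + 1)).obj B)⟦(1 : ℤ)⟧) (d - 1) := t.isLE_shift _ d 1 (d - 1)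
  exact ⟨t.isLE₂ _ (rot_of_distTriang _ (S.triangleLTGE_distinguished (d + 1) B)) d hB.1
      (t.isLE_of_le (((S.truncLT (d + 1)).obj B)⟦(1 : ℤ)⟧) (d - 1) d),
    ⟨hS.ge_add_one_le d _ (S.ge_of_isGE _ _)⟩⟩

theorem shortExactIn_trunc {d : ℤ} {B : C} (hB : t.heart.shift d B) :
    ShortExactIn (t.heart.shift d) ((S.truncLTι (d + 1)).app B) ((S.truncGEπ (d + 1)).app B) :=
  shortExactIn_heart_shift t d (S.triangleLTGE_distinguished (d + 1) B)
    (hS.heart_shift_truncLT hB) hB (hS.heart_shift_truncGE hB)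

theorem truncLT_mem {d : ℤ} {B : C} (hB : t.heart.shift d B) :
    (S.le 0 ⊓ t.heart).shift d ((S.truncLT (d + 1)).obj B) :=
  ⟨S.le_shift d d 0 (add_zero d) _ (S.isLE_truncLT_obj B (d + 1) d).le,
    hS.heart_shift_truncLT hB⟩

theorem truncGE_mem {d : ℤ} {B : C} (hB : t.heart.shift d B) :
    (S.ge 1 ⊓ t.heart).shift d ((S.truncGE (d + 1)).obj B) :=
  ⟨S.ge_shift (d + 1) d 1 rfl _ (S.ge_of_isGE _ _), hS.heart_shift_truncGE hB⟩

/-- The torsion class of a tilt lies in the tilted heart. -/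
theorem heart_shift_of_torsion {d : ℤ} {A : C} (hA : (S.le 0 ⊓ t.heart).shift d A) :
    S.heart.shift d A :=
  ⟨hA.1, hS.ge_zero_le _ hA.2.2⟩

/-- The torsion-free class of a tilt lies in the tilted heart shifted by `-1`. -/
theorem heart_shift_of_torsionFree {d : ℤ} {A : C} (hA : (S.ge 1 ⊓ t.heart).shift d A) :
    S.heart.shift (1 + d) A := by
  have h₁ : S.IsGE (A⟦d⟧) 1 := ⟨hA.1⟩
  -- Together with `h₁` this confines the object to the single `S`-degree 1, whence the degree shift
  -- along the letter 1.
  have h₂ : S.IsLE (A⟦d⟧) 1 := ⟨hS.le_le_add_one 0 _ hA.2.1⟩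
  rw [heart_shift_iff]
  exact ⟨S.isLE_of_shift A (1 + d) d 1, S.isGE_of_shift A (1 + d) d 1⟩

theorem isTorsionPairIn : IsTorsionPairIn t.heart (S.le 0 ⊓ t.heart) (S.ge 1 ⊓ t.heart) where
  left_le := inf_le_right
  right_le := inf_le_right
  hom_eq_zero A B f hA hB := S.zero' f hA.1 hB.1
  exists_shortExact B hB := by
    -- The case `d = 0` of the truncation lemmas; `A⟦0⟧` is only isomorphic to `A`.
    have h₀ : t.heart.shift (0 : ℤ) = t.heart := by
      ext A
      rw [heart_shift_iff, t.mem_heart_iff]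
    rw [← h₀] at hB
    have hA := hS.heart_shift_truncLT hB
    have hE := hS.heart_shift_truncGE hB
    have h := hS.shortExactIn_trunc hB
    rw [h₀] at hA hE h
    exact ⟨_, _, _, _, ⟨(S.isLE_truncLT_obj B _ 0).le, hA⟩, ⟨(S.isGE_truncGE_obj B _ 1).ge, hE⟩, h⟩

end IsTilt

variable {D T : TStructure C}

/-- Raising `i` by one loosens the bound from `D` by one degree, which one shift restores; the bound
from `T` is unchanged. -/
theorem isTilt_basic (h : RightFilterable D T) (i : ℤ) :
    IsTilt (basic h i) (basic h (i + 1)) where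
  ge_zero_le := by
    rw [basic_ge_zero, basic_ge_zero]
    exact inf_le_inf_right _ (D.ge_antitone (by lia))
  ge_one_le := by
    have hle : (basic h (i + 1)).ge 0 ≤ D.ge (-(i + 1)) := by
      rw [basic_ge_zero]
      exact inf_le_left
    have hle' : (basic h (i + 1)).ge 0 ≤ T.ge 0 := by
      rw [basic_ge_zero]
      exact inf_le_right
    rw [basic_ge_zero]
    refine le_inf ?_ (((basic h (i + 1)).ge_antitone zero_le_one).trans hle')
    have := ge_le_ge_shift hle 1
    rwa [zero_add, show -(i + 1) + 1 = -i by ring] at this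

theorem basic_zero (h : RightFilterable D T) (hle : T.le 0 ≤ D.le 0) : basic h 0 = D := by
  refine (eq_basic h 0 D ?_).symm
  have := ge_le_ge_shift (le_le_le_iff.1 hle) (-1)
  simpa using this

/-- On co-aisles the hypothesis reads $T^{\ge 0}\subseteq D^{\ge -n}$, so the intersection is
$T^{\ge 0}$. -/
theorem basic_gap (h : RightFilterable D T) (n : ℕ) (hle : D.le (-n) ≤ T.le 0) :
    basic h n = T := by
  refine (eq_basic h n T ?_).symm
  have := ge_le_ge_shift (le_le_le_iff.1 hle) (-1)
  simpa using this

/-- The vertices of the right t-tree as functors: the children of a vertex at level `l` and of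
degree `d` are its truncations in degrees `≤ d` and `> d` for the basic t-structure `D_{l+1}`. -/
noncomputable def vertex (h : RightFilterable D T) : Word → (D.heart.FullSubcategory ⥤ C)
  | [] => D.heart.ι
  | 0 :: w => vertex h w ⋙ (basic h ((w.length : ℤ) + 1)).truncLT ((Word.degree w : ℤ) + 1)
  | 1 :: w => vertex h w ⋙ (basic h ((w.length : ℤ) + 1)).truncGE ((Word.degree w : ℤ) + 1)

/-- The invariant of the tree: length selects the heart, letter sum the shift. At length `n` it says
that leaves are static. -/
theorem vertex_mem (h : RightFilterable D T) (h₀ : basic h 0 = D) (w : Word)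
    (X : D.heart.FullSubcategory) :
    (basicHeart h w.length).shift (w.degree : ℤ) ((vertex h w).obj X) := by
  induction w with
  | nil =>
    refine (heart_shift_iff _ _ _).2 ?_
    simpa [Word.degree, h₀, vertex] using (D.mem_heart_iff X.obj).1 X.property
  | cons i w ih =>
    have hS := isTilt_basic h (w.length : ℤ)
    match i with
    | 0 =>
      rw [show Word.degree (0 :: w) = Word.degree w from zero_add _]
      exact hS.heart_shift_of_torsion (hS.truncLT_mem ih)
    | 1 =>
      rw [show ((Word.degree (1 :: w) : ℕ) : ℤ) = 1 + Word.degree w from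
        Nat.cast_add 1 (Word.degree w)]
      exact hS.heart_shift_of_torsionFree (hS.truncGE_mem ih)

end TTree

theorem mainTheorem4 {C : Type u} [Category.{v} C]
    [Preadditive C] [HasZeroObject C]
    [HasShift C ℤ]
    [∀ k : ℤ, (shiftFunctor C k).Additive]
    [Pretriangulated C] [IsTriangulated C]
    (D T : TStructure C) (n : ℕ)
    (hDT : TTree.RightFilterable D T) (htype : TTree.IsOfType D T n 0) :
    -- the classes used below are torsion pairs in the right basic hearts
    (∀ l : ℕ, l < n → TTree.IsTorsionPairIn (TTree.basicHeart hDT l)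
      (TTree.torsionClass hDT l) (TTree.torsionFreeClass hDT l)) ∧
    -- the vertices, as functors of the object of the heart, and the maps of the tree
    ∃ (V : TTree.Word → (D.heart.FullSubcategory ⥤ C))
      (ι : ∀ w : TTree.Word, V (0 :: w) ⟶ V w)
      (π : ∀ w : TTree.Word, V w ⟶ V (1 :: w)),
      -- the root of the tree of `X` is `X`
      V [] = D.heart.ι ∧
      -- the short exact sequences, for the vertices of level `l = 0, …, n - 1`
      (∀ w : TTree.Word, w.length < n → ∀ X : D.heart.FullSubcategory,
        TTree.ShortExactIn ((TTree.basicHeart hDT w.length).shift (w.degree : ℤ))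
          ((ι w).app X) ((π w).app X) ∧
        ((TTree.torsionClass hDT w.length).shift (w.degree : ℤ)) ((V (0 :: w)).obj X) ∧
        ((TTree.torsionFreeClass hDT w.length).shift (w.degree : ℤ)) ((V (1 :: w)).obj X)) ∧
      -- the leaves
      (∀ w : TTree.Word, w.length = n → ∀ X : D.heart.FullSubcategory,
        TTree.IsStatic T (w.degree : ℤ) ((V w).obj X)) := by
  have h₀ := TTree.basic_zero hDT htype.1.1
  refine ⟨fun l _ => (TTree.isTilt_basic hDT l).isTorsionPairIn, TTree.vertex hDT,
    fun w => Functor.whiskerLeft (TTree.vertex hDT w) (TStructure.truncLTι _ _),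
    fun w => Functor.whiskerLeft (TTree.vertex hDT w) (TStructure.truncGEπ _ _), rfl,
    fun w _ X => ?_, fun w hw X => ?_⟩
  · have hS := TTree.isTilt_basic hDT (w.length : ℤ)
    have hX := TTree.vertex_mem hDT h₀ w X
    exact ⟨hS.shortExactIn_trunc hX, hS.truncLT_mem hX, hS.truncGE_mem hX⟩
  · have hX := TTree.vertex_mem hDT h₀ w X
    rwa [hw, TTree.basicHeart, TTree.basic_gap hDT n htype.2.1] at hX
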